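/- Let $G\cong\mathbb{C}^3$ be the complex Heisenberg group of matrices $\begin{pmatrix}1&z_1&z_3\\0&1&z_2\\0&0&1\end{pmatrix}$, let $\Gamma\subset G$ be the subgroup of matrices with entries in $\mathbb{Z}[i]$, and let $X$ be the $C^\infty$ manifold underlying the Iwasawa manifold, the quotient of $G$ by left translations of $\Gamma$; tensor fields and forms on $X$ are the $\Gamma$-invariant ones on $\mathbb{C}^3$. For $t=(t_{i\lambda})_{1\le i\le 3,\,1\le\lambda\le 2}\in\mathbb{C}^6$ put $D(t)=t_{11}t_{22}-t_{12}t_{21}$ and $$\zeta_1(t)=z_1+\sum_{\lambda}t_{1\lambda}\bar z_\lambda,\qquad \zeta_2(t)=z_2+\sum_{\lambda}t_{2\lambda}\bar z_\lambda,$$ $$\zeta_3(t)=z_3+\sum_{\lambda}(t_{3\lambda}+t_{2\lambda}z_1)\bar z_\lambda+\tfrac12\left(t_{11}t_{21}\bar z_1^2+2t_{11}t_{22}\bar z_1\bar z_2+t_{12}t_{22}\bar z_2^2\right)-D(t)\bar z_3 .$$ For $t$ near $0$ let $X_t=(X,J_t)$ be $X$ with the complex structure $J_t$ for which $\zeta_1(t),\zeta_2(t),\zeta_3(t)$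 are local holomorphic coordinates (Nakamura's description of the Kuranishi family of the Iwasawa manifold $X_0$), and set $$\alpha_t=d\zeta_1(t),\quad \beta_t=d\zeta_2(t),\quad \gamma_t=d\zeta_3(t)-z_1\,d\zeta_2(t)-(t_{21}\bar z_1+t_{22}\bar z_2)\,d\zeta_1(t),$$ $$\omega_t=i\,\alpha_t\wedge\bar\alpha_t+i\,\beta_t\wedge\bar\beta_t+i\,\gamma_t\wedge\bar\gamma_t .$$ Let $\omega_t^{1,1}$ be the component of $\omega_t$ of bidegree $(1,1)$ with respect to $J_0$. A Gauduchon metric on a compact complex threefold is a $C^\infty$ positive definite real $(1,1)$-form $\omega$ with $\partial\bar\partial\omega^2=0$. Then there is $\varepsilon>0$ such that, with $\Delta=\{t\in\mathbb{C}^6:|t|<\varepsilon\}$ and $\Delta_{[\gamma]}=\{t\in\Delta: t_{31}=t_{32}=0\}$: 1. for every $t\in\Delta$, $\omega_t^{1,1}$ is a Gauduchon metric on $X_0$; 2. $\omega_t^{1,1}$ varies in a $C^\infty$ way with $t\in\Delta$ (that is, it is $C^\infty$ jointly in $t$ and in the point), and $\omega_0^{1,1}=\omega_0$; 3. for every $t\in\Delta_{[\gamma]}$,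 $\omega_t$ is a Gauduchon metric on $X_t$. -/

import Mathlib

noncomputable section

namespace Iwasawa

/-! ### Complex-valued differential forms on `ℂ³`, regarded as a real vector space -/

/-- `ℂ³` with coordinates `(z₁, z₂, z₃) = (z 0, z 1, z 2)`. -/
abbrev C3 : Type := Fin 3 → ℂ

/-- Complex-valued alternating real `k`-forms on the real vector space `ℂ³`, i.e. elements of
`Λᵏ(ℂ³)^* ⊗ ℂ`. -/
abbrev AltForm (k : ℕ) : Type := C3 [⋀^Fin k]→L[ℝ] ℂ

/-- Complex-valued differential `k`-forms on `ℂ³` (no regularity imposed here). -/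
abbrev DiffForm (k : ℕ) : Type := C3 → AltForm k

/-- Complex conjugation of forms. -/
def conjForm {k : ℕ} (a : AltForm k) : AltForm k :=
  (Complex.conjCLE : ℂ →L[ℝ] ℂ).compContinuousAlternatingMap a

/-- A real-linear map `ℂ³ → ℂ` as a `1`-form. -/
def oneForm (a : C3 →L[ℝ] ℂ) : AltForm 1 :=
  ContinuousAlternatingMap.ofSubsingleton ℝ C3 ℂ (0 : Fin 1) a

/-- The tensor product
`(a ⊗ b)(v₁, …, v_{k+l}) = a(v₁, …, v_k) b(v_{k+1}, …, v_{k+l})`. -/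
def tensor {k l : ℕ} (a : AltForm k) (b : AltForm l) :
    ContinuousMultilinearMap ℝ (fun _ : Fin (k + l) => C3) ℂ where
  toFun v := a (fun i => v (Fin.castAdd l i)) * b (fun j => v (Fin.natAdd k j))
  map_update_add' := by
    intro inst v m x y
    refine Fin.addCases (fun i => ?_) (fun j => ?_) m
    · have h1 : ∀ w : C3, (fun i' => Function.update v (Fin.castAdd l i) w (Fin.castAdd l i'))
          = Function.update (fun i' => v (Fin.castAdd l i')) i w := by
        intro w; ext1 i'
        simp [Function.update_apply]
      have h2 : ∀ w : C3, (fun j' => Function.update v (Fin.castAdd l i) w (Fin.natAdd k j'))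
          = (fun j' => v (Fin.natAdd k j')) := by
        intro w; ext1 j'
        have : Fin.natAdd k j' ≠ Fin.castAdd l i := by
          intro h; have := congrArg Fin.val h; simp at this; omega
        simp [this]
      rw [h1, h1, h1, h2, h2, h2, a.map_update_add, add_mul]
    · have h1 : ∀ w : C3, (fun j' => Function.update v (Fin.natAdd k j) w (Fin.natAdd k j'))
          = Function.update (fun j' => v (Fin.natAdd k j')) j w := by
        intro w; ext1 j'
        simp [Function.update_apply]
      have h2 : ∀ w : C3, (fun i' => Function.update v (Fin.natAdd k j) w (Fin.castAdd l i'))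
          = (fun i' => v (Fin.castAdd l i')) := by
        intro w; ext1 i'
        have : Fin.castAdd l i' ≠ Fin.natAdd k j := by
          intro h; have := congrArg Fin.val h; simp at this; omega
        simp [this]
      rw [h1, h1, h1, h2, h2, h2, b.map_update_add, mul_add]
  map_update_smul' := by
    intro inst v m c x
    refine Fin.addCases (fun i => ?_) (fun j => ?_) m
    · have h1 : ∀ w : C3, (fun i' => Function.update v (Fin.castAdd l i) w (Fin.castAdd l i'))
          = Function.update (fun i' => v (Fin.castAdd l i')) i w := by
        intro w; ext1 i'
        simp [Function.update_apply]
      have h2 : ∀ w : C3, (fun j' => Function.update v (Fin.castAdd l i) w (Fin.natAdd k j'))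
          = (fun j' => v (Fin.natAdd k j')) := by
        intro w; ext1 j'
        have : Fin.natAdd k j' ≠ Fin.castAdd l i := by
          intro h; have := congrArg Fin.val h; simp at this; omega
        simp [this]
      rw [h1, h1, h2, h2, a.map_update_smul, smul_mul_assoc]
    · have h1 : ∀ w : C3, (fun j' => Function.update v (Fin.natAdd k j) w (Fin.natAdd k j'))
          = Function.update (fun j' => v (Fin.natAdd k j')) j w := by
        intro w; ext1 j'
        simp [Function.update_apply]
      have h2 : ∀ w : C3, (fun i' => Function.update v (Fin.natAdd k j) w (Fin.castAdd l i'))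
          = (fun i' => v (Fin.castAdd l i')) := by
        intro w; ext1 i'
        have : Fin.castAdd l i' ≠ Fin.natAdd k j := by
          intro h; have := congrArg Fin.val h; simp at this; omega
        simp [this]
      rw [h1, h1, h2, h2, b.map_update_smul, mul_smul_comm]
  cont := by
    refine (a.cont.comp ?_).mul (b.cont.comp ?_) <;> fun_prop

/-- The wedge product `a ∧ b = (1 / (k! l!)) ∑_σ sign(σ) (a ⊗ b) ∘ σ`; for `1`-forms
`(a ∧ b)(v, w) = a(v) b(w) - a(w) b(v)`. -/
def wedge {k l : ℕ} (a : AltForm k) (b : AltForm l) : AltForm (k + l) :=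
  (((k.factorial : ℂ) * (l.factorial : ℂ))⁻¹) •
    ContinuousMultilinearMap.alternatization (tensor a b)

/-! ### Bidegrees with respect to a complex structure -/

/-- The complex-multilinear extension of `ω`, evaluated on the vectors
`v_i^{1,0} = (v_i - √-1 J v_i) / 2` for `i ∈ S` and `v_i^{0,1} = (v_i + √-1 J v_i) / 2`
for `i ∉ S`; `T` is the set of slots from which the term with `J v_i` is taken. -/
def splitEval (J : C3 →L[ℝ] C3) {k : ℕ} (S : Finset (Fin k)) (ω : AltForm k) :
    ContinuousMultilinearMap ℝ (fun _ : Fin k => C3) ℂ :=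
  ∑ T : Finset (Fin k),
    (((1 : ℂ) / 2 ^ k) * ∏ i ∈ T, (if i ∈ S then -Complex.I else Complex.I)) •
      ω.toContinuousMultilinearMap.compContinuousLinearMap
        (fun i => if i ∈ T then J else ContinuousLinearMap.id ℝ C3)

lemma splitEval_apply (J : C3 →L[ℝ] C3) {k : ℕ} (S : Finset (Fin k)) (ω : AltForm k)
    (v : Fin k → C3) :
    splitEval J S ω v = ∑ T : Finset (Fin k),
      (((1 : ℂ) / 2 ^ k) * ∏ i ∈ T, (if i ∈ S then -Complex.I else Complex.I)) *
        ω (fun i => if i ∈ T then J (v i) else v i) := by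
  simp only [splitEval, sum_apply, smul_apply,
    ContinuousMultilinearMap.compContinuousLinearMap_apply, smul_eq_mul]
  refine Finset.sum_congr rfl fun T _ => ?_
  congr 1
  change ω _ = ω _
  congr 1
  ext1 i
  split_ifs <;> rfl

lemma splitEval_map_perm (J : C3 →L[ℝ] C3) {k : ℕ} (S : Finset (Fin k)) (ω : AltForm k)
    (v : Fin k → C3) (e : Equiv.Perm (Fin k)) :
    splitEval J (S.map e.toEmbedding) ω v =
      ((Equiv.Perm.sign e : ℤ) : ℂ) * splitEval J S ω (v ∘ e) := by
  rw [splitEval_apply, splitEval_apply, Finset.mul_sum]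
  refine (Fintype.sum_equiv (Equiv.finsetCongr e) _ _ fun T => ?_).symm
  have h := ω.toAlternatingMap.map_perm
    (fun i => if i ∈ T.map e.toEmbedding then J (v i) else v i) e
  have hv : (fun i => if i ∈ T then J ((v ∘ e) i) else (v ∘ e) i)
      = (fun i => if i ∈ T.map e.toEmbedding then J (v i) else v i) ∘ e := by
    ext1 i; simp
  rw [hv]
  have h' : ω ((fun i => if i ∈ T.map e.toEmbedding then J (v i) else v i) ∘ e)
      = ((Equiv.Perm.sign e : ℤ) : ℂ) *
        ω (fun i => if i ∈ T.map e.toEmbedding then J (v i) else v i) := by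
    refine h.trans ?_
    rcases Int.units_eq_one_or (Equiv.Perm.sign e) with hs | hs <;> simp [hs]
  have hsq : ((Equiv.Perm.sign e : ℤ) : ℂ) * ((Equiv.Perm.sign e : ℤ) : ℂ) = 1 := by
    rcases Int.units_eq_one_or (Equiv.Perm.sign e) with hs | hs <;> simp [hs]
  rw [h', Equiv.finsetCongr_apply]
  simp only [Finset.prod_map, Equiv.coe_toEmbedding, Finset.mem_map_equiv, Equiv.symm_apply_apply]
  linear_combination (((1 : ℂ) / 2 ^ k) * ∏ i ∈ T, (if i ∈ S then -Complex.I else Complex.I)) *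
        ω (fun i => if e.symm i ∈ T then J (v i) else v i) * hsq

/-- The component of bidegree `(p, q)` with respect to `J` of a complex-valued `k`-form `ω`:
`ω^{p,q}(v₁, …, v_k)` is the sum, over all ways to choose `p` slots that receive `v_i^{1,0}`
while the other `q` slots receive `v_i^{0,1}`, of the values of the complex-multilinear extension
of `ω`. It is zero if `p + q ≠ k`. -/
def typeComp (J : C3 →L[ℝ] C3) (p q : ℕ) {k : ℕ} (ω : AltForm k) : AltForm k :=
  { (∑ S : Finset (Fin k) with S.card = p ∧ Sᶜ.card = q, splitEval J S ω :
      ContinuousMultilinearMap ℝ (fun _ : Fin k => C3) ℂ) with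
    map_eq_zero_of_eq' := by
      intro v i j hv hij
      change (∑ S : Finset (Fin k) with S.card = p ∧ Sᶜ.card = q, splitEval J S ω :
        ContinuousMultilinearMap ℝ (fun _ : Fin k => C3) ℂ) v = 0
      rw [sum_apply]
      have hvs : v ∘ (Equiv.swap i j) = v := by
        ext1 a
        simp only [Function.comp_apply, Equiv.swap_apply_def]
        split_ifs with h1 h2
        · rw [h1, hv]
        · rw [h2, hv]
        · rfl
      have hneg : (∑ S : Finset (Fin k) with S.card = p ∧ Sᶜ.card = q, splitEval J S ω v)
          = -∑ S : Finset (Fin k) with S.card = p ∧ Sᶜ.card = q, splitEval J S ω v := by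
        rw [← Finset.sum_neg_distrib]
        refine (Finset.sum_equiv (Equiv.finsetCongr (Equiv.swap i j)) (fun S => ?_)
          (fun S _ => ?_)).symm
        · simp [Equiv.finsetCongr_apply, Finset.card_compl]
        · rw [Equiv.finsetCongr_apply, splitEval_map_perm, hvs, Equiv.Perm.sign_swap hij]
          simp
      exact self_eq_neg.mp hneg }

/-- `∂η = (dη)^{p+1,q}` for a form `η` of bidegree `(p, q)`. -/
def del (J : C3 → C3 →L[ℝ] C3) (p q : ℕ) {k : ℕ} (η : DiffForm k) : DiffForm (k + 1) :=
  fun z => typeComp (J z) (p + 1) q (extDeriv η z)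

/-- `∂̄η = (dη)^{p,q+1}` for a form `η` of bidegree `(p, q)`. -/
def delbar (J : C3 → C3 →L[ℝ] C3) (p q : ℕ) {k : ℕ} (η : DiffForm k) : DiffForm (k + 1) :=
  fun z => typeComp (J z) p (q + 1) (extDeriv η z)

/-! ### The Iwasawa manifold `X = Γ \ G`

The Heisenberg group `G` is identified with `ℂ³` through the entries `z₁, z₂, z₃` of the matrices.
It is the universal cover of `X`, so that differential forms and tensor fields on the smooth
manifold `X` are the `Γ`-invariant ones on `ℂ³`. -/

/-- The element of the Heisenberg group with entries `z₁, z₂, z₃`. -/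
def heisMatrix (z : C3) : Matrix (Fin 3) (Fin 3) ℂ :=
  !![1, z 0, z 2; 0, 1, z 1; 0, 0, 1]

/-- Left translation by `a` in the Heisenberg group. -/
def translate (a z : C3) : C3 := ![a 0 + z 0, a 1 + z 1, a 2 + a 0 * z 1 + z 2]

lemma heisMatrix_translate (a z : C3) :
    heisMatrix (translate a z) = heisMatrix a * heisMatrix z := by
  ext i j
  fin_cases i <;> fin_cases j <;>
    simp [heisMatrix, translate, Matrix.mul_apply, Fin.sum_univ_three] <;> ring

/-- The discrete subgroup `Γ` of elements with entries in `ℤ[i]`. -/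
def lattice : Set C3 := {a | ∀ i, ∃ m n : ℤ, a i = m + n * Complex.I}

/-- `ω` is (the pull-back to `ℂ³` of) a smooth complex-valued `k`-form on `X`. -/
def IsFormOnX {k : ℕ} (ω : DiffForm k) : Prop :=
  ContDiff ℝ (⊤ : ℕ∞) ω ∧
    ∀ a ∈ lattice, ∀ z : C3,
      (ω (translate a z)).compContinuousLinearMap (fderiv ℝ (translate a) z) = ω z

/-- `J` is (the pull-back to `ℂ³` of) a smooth almost complex structure on `X`. -/
structure IsAlmostComplexOnX (J : C3 → C3 →L[ℝ] C3) : Prop where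
  smooth : ContDiff ℝ (⊤ : ℕ∞) J
  sq : ∀ z v, J z (J z v) = -v
  invariant : ∀ a ∈ lattice, ∀ z v,
    J (translate a z) (fderiv ℝ (translate a) z v) = fderiv ℝ (translate a) z (J z v)

/-- `ω` is a Hermitian metric on `(X, J)`: a smooth real positive definite form of type `(1, 1)`. -/
structure IsHermitianMetric (J : C3 → C3 →L[ℝ] C3) (ω : DiffForm 2) : Prop where
  complexStructure : IsAlmostComplexOnX J
  form : IsFormOnX ω
  type_one_one : ∀ z, typeComp (J z) 1 1 (ω z) = ω z
  real : ∀ z, conjForm (ω z) = ω z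
  pos : ∀ z v, v ≠ 0 → 0 < (ω z ![v, J z v]).re

/-- `ω` is a Gauduchon metric on the complex threefold `(X, J)`: a Hermitian metric with
`∂∂̄(ω ∧ ω) = 0`. -/
def IsGauduchonMetric (J : C3 → C3 →L[ℝ] C3) (ω : DiffForm 2) : Prop :=
  IsHermitianMetric J ω ∧
    del J 2 3 (delbar J 2 2 (fun z => wedge (ω z) (ω z))) = 0

/-! ### The Kuranishi family, in Nakamura's coordinates -/

/-- The six parameters: `t_{iλ}`, `1 ≤ i ≤ 3`, `1 ≤ λ ≤ 2`, is `t (i-1) (λ-1)`. -/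
abbrev Param : Type := Fin 3 → Fin 2 → ℂ

/-- `D(t) = t₁₁ t₂₂ - t₁₂ t₂₁`. -/
def paramDet (t : Param) : ℂ := t 0 0 * t 1 1 - t 0 1 * t 1 0

/-- Complex conjugation on `ℂ`. -/
local notation "conj" => starRingEnd ℂ

/-- The holomorphic coordinates `ζ₁(t), ζ₂(t), ζ₃(t)` of `X_t`, as functions of `z`. -/
def zeta (t : Param) (z : C3) : C3 :=
  ![z 0 + (t 0 0 * conj (z 0) + t 0 1 * conj (z 1)),
    z 1 + (t 1 0 * conj (z 0) + t 1 1 * conj (z 1)),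
    z 2 + ((t 2 0 + t 1 0 * z 0) * conj (z 0) + (t 2 1 + t 1 1 * z 0) * conj (z 1))
      + (1 / 2) * (t 0 0 * t 1 0 * conj (z 0) ^ 2
          + 2 * (t 0 0 * t 1 1) * (conj (z 0) * conj (z 1))
          + t 0 1 * t 1 1 * conj (z 1) ^ 2)
      - paramDet t * conj (z 2)]

/-- The complex structure `J_t` of `X_t`: the one for which `ζ(t)` is a holomorphic chart, i.e.
the pull-back under `ζ(t)` of multiplication by `i`. -/
def complexStr (t : Param) (z : C3) : C3 →L[ℝ] C3 :=
  (fderiv ℝ (zeta t) z).inverse ∘L (Complex.I • ContinuousLinearMap.id ℝ C3) ∘L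
    fderiv ℝ (zeta t) z

/-- The differential `dζ_j(t)`. -/
def dzeta (t : Param) (j : Fin 3) : DiffForm 1 :=
  fun z => oneForm (fderiv ℝ (fun w => zeta t w j) z)

/-- `α_t = dζ₁(t)`. -/
def alphaForm (t : Param) : DiffForm 1 := dzeta t 0

/-- `β_t = dζ₂(t)`. -/
def betaForm (t : Param) : DiffForm 1 := dzeta t 1

/-- `γ_t = dζ₃(t) - z₁ dζ₂(t) - (t₂₁ z̄₁ + t₂₂ z̄₂) dζ₁(t)`. -/
def gammaForm (t : Param) : DiffForm 1 := fun z =>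
  dzeta t 2 z - z 0 • dzeta t 1 z - (t 1 0 * conj (z 0) + t 1 1 * conj (z 1)) • dzeta t 0 z

/-- `ω_t = i α_t ∧ ᾱ_t + i β_t ∧ β̄_t + i γ_t ∧ γ̄_t`. -/
def omegaForm (t : Param) : DiffForm 2 := fun z =>
  Complex.I • wedge (alphaForm t z) (conjForm (alphaForm t z))
    + Complex.I • wedge (betaForm t z) (conjForm (betaForm t z))
    + Complex.I • wedge (gammaForm t z) (conjForm (gammaForm t z))

/-- `ω_t^{1,1}`: the component of `ω_t` of bidegree `(1, 1)` with respect to `J_0`. -/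
def omegaForm11 (t : Param) : DiffForm 2 := fun z =>
  typeComp (complexStr 0 z) 1 1 (omegaForm t z)

end Iwasawa

end

noncomputable section

namespace Iwasawa

/-! ### Left-invariant forms on the Heisenberg group -/

/-! Everything in sight is invariant under the whole Heisenberg group, not only under the lattice.
Write φ = (dz₁, dz₂, dz₃ - z₁ dz₂) for the left-invariant coframe. Differentiating ζ(t) gives (α_t,
β_t, γ_t) = φ + A_t φ̄ with A_t constant on the group (`hasFDerivAt_zeta`). Hence ω_t, J_t and
ω_t^{1,1} have constant coefficients in φ.

The Gauduchon equation is then automatic. For a left-invariant J and metric, ∂̄(ω²) is a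
left-invariant 5-form on a unimodular group of real dimension 6, hence closed
(`IsLeftInvariant.extDeriv_eq_zero`), so ∂ of it vanishes (`IsHermitianMetric.isGauduchonMetric`).

What remains is linear algebra at one point. For small t the map 1 + A_t is injective and carries
J_t to multiplication by i and ω_t to the standard Hermitian form, so ω_t is positive on X_t. For
J_0, put p = φ(v). Antilinearity of A_t gives (1 + A_t)(ip) = i(p - A_t p), and ω_t^{1,1}(v, iv) = 2
∑ (|p_j|² - |(A_t p)_j|²), which is positive once A_t is small (`stdForm_add_I_smul_sub`,
`norm_antilinearPart_apply_le`). -/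

/-- The left-invariant coframe `(dz₁, dz₂, dz₃ - z₁ dz₂)`. -/
def coframe (z : C3) : C3 →L[ℝ] C3 :=
  ContinuousLinearMap.pi ![ContinuousLinearMap.proj 0, ContinuousLinearMap.proj 1,
    ContinuousLinearMap.proj 2 - z 0 • ContinuousLinearMap.proj 1]

lemma coframe_apply (z v : C3) : coframe z v = ![v 0, v 1, v 2 - z 0 * v 1] := by
  ext i; fin_cases i <;> simp [coframe]

lemma coframe_zero (v : C3) : coframe 0 v = v := by
  ext i; fin_cases i <;> simp [coframe_apply]

/-- The inverse of `coframe z`. -/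
def frame (z : C3) : C3 →L[ℝ] C3 := coframe (-z)

lemma frame_coframe (z v : C3) : frame z (coframe z v) = v := by
  ext i; fin_cases i <;> simp [frame, coframe_apply]

lemma coframe_injective (z : C3) : Function.Injective (coframe z) :=
  Function.LeftInverse.injective (frame_coframe z)

lemma coframe_smul (z : C3) (c : ℂ) (v : C3) : coframe z (c • v) = c • coframe z v := by
  ext i; fin_cases i <;> simp [coframe_apply]; ring

/-- The derivative of `z ↦ coframe z w`. -/
def coframeDeriv (w : C3) : C3 →L[ℝ] C3 :=
  ContinuousLinearMap.pi ![0, 0, -(w 1 • ContinuousLinearMap.proj 0)]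

lemma coframeDeriv_apply (w u : C3) : coframeDeriv w u = ![0, 0, -(w 1 * u 0)] := by
  ext i; fin_cases i <;> simp [coframeDeriv]

lemma hasFDerivAt_coframe_apply (w z : C3) :
    HasFDerivAt (fun z => coframe z w) (coframeDeriv w) z := by
  have h : (fun z => coframe z w) = fun z => w + coframeDeriv w z := by
    funext z
    ext i; fin_cases i <;> simp [coframe_apply, coframeDeriv_apply]; ring
  rw [h]
  exact (coframeDeriv w).hasFDerivAt.const_add w

lemma contDiff_coframe_apply (w : C3) {n : WithTop ℕ∞} : ContDiff ℝ n fun z => coframe z w := by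
  have h : (fun z => coframe z w) = fun z => w + coframeDeriv w z := by
    funext z
    ext i; fin_cases i <;> simp [coframe_apply, coframeDeriv_apply]; ring
  rw [h]
  exact contDiff_const.add (coframeDeriv w).contDiff

/-- A family of alternating forms is smooth as soon as all its values are. -/
lemma contDiff_altForm {E : Type*} [NormedAddCommGroup E] [NormedSpace ℝ E] {n : WithTop ℕ∞}
    {k : ℕ} {f : E → AltForm k} (h : ∀ v, ContDiff ℝ n fun x => f x v) : ContDiff ℝ n f := by
  let b := Module.finBasis ℝ C3
  let ev : AltForm k →ₗ[ℝ] ((Fin k → Fin (Module.finrank ℝ C3)) → ℂ) :=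
    { toFun := fun a s => a fun i => b (s i)
      map_add' := fun _ _ => rfl
      map_smul' := fun _ _ => rfl }
  have hinj : LinearMap.ker ev = ⊥ := by
    rw [LinearMap.ker_eq_bot]
    intro a a' haa
    have := Module.Basis.ext_alternating (f := a.toAlternatingMap) (g := a'.toAlternatingMap) b
      fun s _ => congrFun haa s
    exact ContinuousAlternatingMap.toAlternatingMap_injective this
  obtain ⟨g, hg⟩ := ev.exists_leftInverse_of_injective hinj
  -- Forms are determined by their values on basis tuples, so `f` is a fixed linear map applied to
  -- finitely many of its values.
  have hf : f = fun x => LinearMap.toContinuousLinearMap g (ev (f x)) := by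
    funext x
    exact (LinearMap.congr_fun hg (f x)).symm
  rw [hf]
  refine (LinearMap.toContinuousLinearMap g).contDiff.comp (contDiff_pi.2 fun s => ?_)
  exact h _

/-- Left-invariant forms on the Heisenberg group. -/
def IsLeftInvariant {k : ℕ} (η : DiffForm k) : Prop :=
  ∀ z, η z = (η 0).compContinuousLinearMap (coframe z)

lemma IsLeftInvariant.apply {k : ℕ} {η : DiffForm k} (h : IsLeftInvariant η) (z : C3)
    (v : Fin k → C3) : η z v = η 0 fun i => coframe z (v i) := by
  rw [h z]; rfl

lemma isLeftInvariant_of_apply {k : ℕ} {η : DiffForm k} (a : AltForm k)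
    (h : ∀ z v, η z v = a fun i => coframe z (v i)) : IsLeftInvariant η := by
  intro z
  ext v
  rw [h]
  refine Eq.trans ?_ (h 0 _).symm
  simp only [coframe_zero]
  rfl

lemma IsLeftInvariant.contDiff {k : ℕ} {η : DiffForm k} (h : IsLeftInvariant η)
    {n : WithTop ℕ∞} : ContDiff ℝ n η := by
  refine contDiff_altForm fun v => ?_
  rw [show (fun z => η z v) = fun z => η 0 fun i => coframe z (v i) from
    funext fun z => h.apply z v]
  exact (η 0).toContinuousMultilinearMap.contDiff.comp
    (contDiff_pi.2 fun i => contDiff_coframe_apply (v i))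

lemma hasFDerivAt_translate (a z : C3) :
    HasFDerivAt (translate a) (coframe ![-a 0, 0, 0]) z := by
  have h : translate a = fun z => a + coframe ![-a 0, 0, 0] z := by
    funext z
    ext i; fin_cases i <;> simp [coframe_apply, translate]; ring
  rw [h]
  exact (coframe _).hasFDerivAt.const_add a

/-- The shear a₁ v₂ produced by differentiating left translation cancels the shift of z₁ to a₁ + z₁
in the third covector. -/
lemma coframe_translate (a z v : C3) :
    coframe (translate a z) (fderiv ℝ (translate a) z v) = coframe z v := by
  rw [(hasFDerivAt_translate a z).fderiv]
  ext i; fin_cases i <;> simp [coframe_apply, translate]; ring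

lemma IsLeftInvariant.isFormOnX {k : ℕ} {η : DiffForm k} (h : IsLeftInvariant η) :
    IsFormOnX η := by
  refine ⟨h.contDiff, fun a _ z => ?_⟩
  ext v
  have : (η (translate a z)).compContinuousLinearMap (fderiv ℝ (translate a) z) v
      = η (translate a z) fun i => fderiv ℝ (translate a) z (v i) := rfl
  rw [this, h.apply, h.apply z]
  simp only [coframe_translate]

/-- Leibniz rule: all dependence on the point sits in the coframe, so each term differentiates one
slot. This is the Maurer–Cartan formula, with `coframeDeriv` encoding d(dz₃ - z₁ dz₂) = -dz₁ ∧ dz₂.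
-/
lemma IsLeftInvariant.extDeriv_apply {k : ℕ} {η : DiffForm k} (h : IsLeftInvariant η) (z : C3)
    (v : Fin (k + 1) → C3) :
    extDeriv η z v = ∑ i : Fin (k + 1), (-1) ^ i.val • ∑ j : Fin k,
      η 0 (Function.update (fun l => coframe z (v (i.succAbove l))) j
        (coframeDeriv (v (i.succAbove j)) (v i))) := by
  rw [_root_.extDeriv_apply (h.contDiff (n := 1) |>.differentiable (by simp) z)]
  refine Finset.sum_congr rfl fun i _ => ?_
  congr 1
  have hd := HasFDerivAt.multilinear_comp (η 0).toContinuousMultilinearMap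
    (fun l => hasFDerivAt_coframe_apply (v (i.succAbove l)) z)
  have he : (fun x => η x (i.removeNth v))
      = fun x => (η 0).toContinuousMultilinearMap fun l => coframe x (v (i.succAbove l)) := by
    funext x
    rw [h.apply]; rfl
  rw [he, hd.fderiv]
  simp

lemma IsLeftInvariant.extDeriv {k : ℕ} {η : DiffForm k} (h : IsLeftInvariant η) :
    IsLeftInvariant (extDeriv η) := by
  refine isLeftInvariant_of_apply (_root_.extDeriv η 0) fun z v => ?_
  rw [h.extDeriv_apply, h.extDeriv_apply]
  refine Finset.sum_congr rfl fun i _ => ?_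
  congr 1
  refine Finset.sum_congr rfl fun j _ => ?_
  congr 1
  funext l
  by_cases hl : l = j
  -- `coframeDeriv` reads only the first two coordinates of its arguments, and `coframe z` leaves
  -- those unchanged.
  · subst hl
    simp [coframeDeriv_apply, coframe_apply]
  · simp [hl, coframe_zero]

/-- An alternating form vanishes if it is evaluated on a complex multiple of `w` together with
`w` and `I • w`. -/
lemma altForm_eq_zero_of_complex_span {k : ℕ} (a : AltForm k) (v : Fin k → C3) (w : C3) (c : ℂ)
    {i j l : Fin k} (hi : i ≠ l) (hj : j ≠ l) (hvi : v i = w) (hvj : v j = Complex.I • w) :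
    a (Function.update v l (c • w)) = 0 := by
  have hc : c • w = c.re • w + c.im • (Complex.I • w) := by
    conv_lhs => rw [← Complex.re_add_im c]
    rw [add_smul, mul_smul]
    simp
  rw [hc, a.map_update_add, a.map_update_smul, a.map_update_smul,
    a.map_eq_zero_of_eq _ (i := i) (j := l) (by simp [hi, hvi]) hi,
    a.map_eq_zero_of_eq _ (i := j) (j := l) (by simp [hj, hvj]) hj]
  simp

/-- The Heisenberg group is unimodular: left-invariant `5`-forms are closed. -/
lemma IsLeftInvariant.extDeriv_eq_zero {η : DiffForm 5} (h : IsLeftInvariant η) :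
    _root_.extDeriv η = 0 := by
  have h0 : _root_.extDeriv η 0 = 0 := by
    apply ContinuousAlternatingMap.toAlternatingMap_injective
    refine Module.Basis.ext_alternating (Pi.basis fun _ : Fin 3 => Complex.basisOneI)
      fun s hs => ?_
    have hsb : Function.Bijective s := by
      rw [Fintype.bijective_iff_injective_and_card]
      exact ⟨hs, by simp⟩
    refine (h.extDeriv_apply 0 _).trans ?_
    refine Finset.sum_eq_zero fun i _ => ?_
    rw [Finset.sum_eq_zero, smul_zero]
    intro j _
    -- The six arguments run through the real basis e_l, i e_l. A term puts a multiple of e₃ into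
    -- slot j, and is nonzero only if the removed vector lies in the z₁-plane and the replaced one
    -- in the z₂-plane. Then e₃ and i e₃ both survive in other slots, so three arguments lie in one
    -- real plane.
    obtain ⟨a, ha⟩ := hsb.2 ⟨2, 0⟩
    obtain ⟨b, hb⟩ := hsb.2 ⟨2, 1⟩
    simp only [coframe_zero]
    by_cases hi : (s i).1 = 0
    swap
    · refine (η 0).toMultilinearMap.map_coord_zero j ?_
      ext l
      fin_cases l <;> simp [coframeDeriv_apply, Pi.basis_apply, Ne.symm hi]
    by_cases hj : (s (i.succAbove j)).1 = 1
    swap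
    · refine (η 0).toMultilinearMap.map_coord_zero j ?_
      ext l
      fin_cases l <;> simp [coframeDeriv_apply, Pi.basis_apply, Ne.symm hj]
    have hai : a ≠ i := by rintro rfl; simp [ha] at hi
    have hbi : b ≠ i := by rintro rfl; simp [hb] at hi
    obtain ⟨a, rfl⟩ := Fin.exists_succAbove_eq hai
    obtain ⟨b, rfl⟩ := Fin.exists_succAbove_eq hbi
    have haj : a ≠ j := by rintro rfl; simp [ha] at hj
    have hbj : b ≠ j := by rintro rfl; simp [hb] at hj
    have hd : ∀ w u : C3, coframeDeriv w u = (-(w 1 * u 0)) • (Pi.single 2 1 : C3) := by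
      intro w u
      ext l
      fin_cases l <;> simp [coframeDeriv_apply]
    rw [hd]
    refine altForm_eq_zero_of_complex_span _ _ _ _ haj hbj ?_ ?_
    · simp [ha, Pi.basis_apply]
    · simp only [hb, Pi.basis_apply]
      ext l
      fin_cases l <;> simp
  funext z
  rw [h.extDeriv z, h0]
  rfl

/-! ### Left-invariant endomorphism fields -/

/-- Left-invariant fields of endomorphisms of the tangent bundle. -/
def IsLeftInvariantEnd (J : C3 → C3 →L[ℝ] C3) : Prop :=
  ∀ z v, coframe z (J z v) = J 0 (coframe z v)

lemma IsLeftInvariantEnd.typeComp {J : C3 → C3 →L[ℝ] C3} (hJ : IsLeftInvariantEnd J) (p q : ℕ)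
    {k : ℕ} {η : DiffForm k} (h : IsLeftInvariant η) :
    IsLeftInvariant fun z => typeComp (J z) p q (η z) := by
  refine isLeftInvariant_of_apply (Iwasawa.typeComp (J 0) p q (η 0)) fun z v => ?_
  change (∑ S : Finset (Fin k) with S.card = p ∧ Sᶜ.card = q, splitEval (J z) S (η z)) v
    = (∑ S : Finset (Fin k) with S.card = p ∧ Sᶜ.card = q, splitEval (J 0) S (η 0)) _
  simp only [sum_apply, splitEval_apply]
  refine Finset.sum_congr rfl fun S _ => Finset.sum_congr rfl fun T _ => ?_
  rw [h.apply]
  congr 2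
  funext i
  split_ifs
  · exact hJ z _
  · rfl

lemma IsLeftInvariantEnd.isAlmostComplexOnX {J : C3 → C3 →L[ℝ] C3} (hJ : IsLeftInvariantEnd J)
    (hsq : ∀ v, J 0 (J 0 v) = -v) : IsAlmostComplexOnX J where
  smooth := by
    rw [contDiff_clm_apply_iff]
    intro v
    -- This is `frame z` applied to `J 0 (coframe z v)`: the inverse shear adds z₁ w₂ to the third
    -- coordinate of w.
    have h : (fun z => J z v) = fun z =>
        J 0 (coframe z v) - coframeDeriv (J 0 (coframe z v)) z := by
      funext z
      rw [← hJ]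
      ext i; fin_cases i <;> simp [coframe_apply, coframeDeriv_apply]; ring
    rw [h]
    have h1 : ContDiff ℝ (⊤ : ℕ∞) fun z => J 0 (coframe z v) :=
      (J 0).contDiff.comp (contDiff_coframe_apply v)
    refine h1.sub (contDiff_pi.2 fun i => ?_)
    simp only [coframeDeriv_apply]
    have h2 : ContDiff ℝ (⊤ : ℕ∞) fun z => J 0 (coframe z v) 1 := contDiff_pi.1 h1 1
    have h3 : ContDiff ℝ (⊤ : ℕ∞) fun z : C3 => z 0 := contDiff_apply ℝ ℂ 0
    fin_cases i
    · exact contDiff_const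
    · exact contDiff_const
    · exact (h2.mul h3).neg
  sq := fun z v => coframe_injective z (by rw [hJ, hJ, hsq, map_neg])
  invariant := fun a _ z v => coframe_injective (translate a z) (by
    rw [hJ, coframe_translate, coframe_translate, hJ])

lemma IsLeftInvariant.wedge {k l : ℕ} {η : DiffForm k} {θ : DiffForm l} (hη : IsLeftInvariant η)
    (hθ : IsLeftInvariant θ) : IsLeftInvariant fun z => wedge (η z) (θ z) := by
  refine isLeftInvariant_of_apply (Iwasawa.wedge (η 0) (θ 0)) fun z v => ?_
  simp only [Iwasawa.wedge, ContinuousAlternatingMap.smul_apply,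
    ContinuousMultilinearMap.alternatization_apply_apply]
  congr 1
  refine Finset.sum_congr rfl fun σ _ => ?_
  congr 1
  change η z _ * θ z _ = η 0 _ * θ 0 _
  exact congrArg₂ (· * ·) (hη.apply z _) (hθ.apply z _)

lemma typeComp_zero (J : C3 →L[ℝ] C3) (p q k : ℕ) : typeComp J p q (0 : AltForm k) = 0 := by
  ext v
  change (∑ S : Finset (Fin k) with S.card = p ∧ Sᶜ.card = q, splitEval J S 0) v = 0
  simp only [sum_apply, splitEval_apply]
  exact Finset.sum_eq_zero fun S _ => Finset.sum_eq_zero fun T _ => mul_zero _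

lemma IsLeftInvariant.del_eq_zero {η : DiffForm 5} (h : IsLeftInvariant η)
    (J : C3 → C3 →L[ℝ] C3) (p q : ℕ) : del J p q η = 0 := by
  funext z
  rw [del, h.extDeriv_eq_zero]
  exact typeComp_zero _ _ _ _

/-- A left-invariant Hermitian metric is Gauduchon. -/
lemma IsHermitianMetric.isGauduchonMetric {J : C3 → C3 →L[ℝ] C3} {ω : DiffForm 2}
    (h : IsHermitianMetric J ω) (hJ : IsLeftInvariantEnd J) (hω : IsLeftInvariant ω) :
    IsGauduchonMetric J ω := by
  refine ⟨h, ?_⟩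
  have h5 : IsLeftInvariant (delbar J 2 2 fun z => wedge (ω z) (ω z)) :=
    hJ.typeComp 2 3 (hω.wedge hω).extDeriv
  exact h5.del_eq_zero J 2 3

/-! ### The coframe `(α_t, β_t, γ_t)` -/

local notation "conj" => starRingEnd ℂ

/-- The conjugate-linear part of `(α_t, β_t, γ_t)` in the frame dual to the left-invariant
coframe. -/
def antilinearPart (t : Param) : C3 →L[ℝ] C3 :=
  let c (i : Fin 3) : C3 →L[ℝ] ℂ := Complex.conjCLE.toContinuousLinearMap ∘L
    ContinuousLinearMap.proj i
  ContinuousLinearMap.pi ![t 0 0 • c 0 + t 0 1 • c 1, t 1 0 • c 0 + t 1 1 • c 1,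
    t 2 0 • c 0 + t 2 1 • c 1 - paramDet t • c 2]

lemma antilinearPart_apply (t : Param) (w : C3) :
    antilinearPart t w = ![t 0 0 * conj (w 0) + t 0 1 * conj (w 1),
      t 1 0 * conj (w 0) + t 1 1 * conj (w 1),
      t 2 0 * conj (w 0) + t 2 1 * conj (w 1) - paramDet t * conj (w 2)] := by
  ext i; fin_cases i <;> simp [antilinearPart]

lemma antilinearPart_zero (w : C3) : antilinearPart 0 w = 0 := by
  ext i; fin_cases i <;> simp [antilinearPart_apply, paramDet]

lemma antilinearPart_I_smul (t : Param) (w : C3) :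
    antilinearPart t (Complex.I • w) = -(Complex.I • antilinearPart t w) := by
  ext i; fin_cases i <;> simp [antilinearPart_apply] <;> ring

/-- The norms are sup norms. Each row has two entries of size at most 1/10, and the third also has
|D(t)| ≤ 1/50, so 1/5 + 1/50 < 1/4. The bound 1/4 suffices below because 1/4 < 1 (injectivity) and 3
· (1/4)² < 1 (positivity). -/
lemma norm_antilinearPart_apply_le {t : Param} (ht : ‖t‖ < 1 / 10) (w : C3) (j : Fin 3) :
    ‖antilinearPart t w j‖ ≤ 1 / 4 * ‖w‖ := by
  have h1 : ∀ i l, ‖t i l‖ ≤ 1 / 10 := fun i l =>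
    ((norm_le_pi_norm (t i) l).trans (norm_le_pi_norm t i)).trans ht.le
  have h2 : ∀ i l (x : ℂ), ‖x‖ ≤ ‖w‖ → ‖t i l * conj x‖ ≤ 1 / 10 * ‖w‖ := fun i l x hx => by
    rw [norm_mul, RCLike.norm_conj]
    exact mul_le_mul (h1 i l) hx (norm_nonneg _) (by norm_num)
  have hD : ‖paramDet t‖ ≤ 1 / 50 := by
    have h3 : ∀ i l i' l', ‖t i l * t i' l'‖ ≤ 1 / 100 := fun i l i' l' => by
      rw [norm_mul]
      calc _ ≤ (1 / 10 : ℝ) * (1 / 10) :=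
            mul_le_mul (h1 i l) (h1 i' l') (norm_nonneg _) (by norm_num)
        _ = _ := by norm_num
    calc _ ≤ ‖t 0 0 * t 1 1‖ + ‖t 0 1 * t 1 0‖ := norm_sub_le _ _
      _ ≤ 1 / 100 + 1 / 100 := add_le_add (h3 _ _ _ _) (h3 _ _ _ _)
      _ = _ := by norm_num
  have hw := norm_le_pi_norm w
  have hrow : ∀ i, ‖t i 0 * conj (w 0) + t i 1 * conj (w 1)‖ ≤ 1 / 5 * ‖w‖ := fun i => by
    have := norm_add_le (t i 0 * conj (w 0)) (t i 1 * conj (w 1))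
    have := h2 i 0 _ (hw 0)
    have := h2 i 1 _ (hw 1)
    linarith
  have hDw : ‖paramDet t * conj (w 2)‖ ≤ 1 / 50 * ‖w‖ := by
    rw [norm_mul, RCLike.norm_conj]
    exact mul_le_mul hD (hw 2) (norm_nonneg _) (by norm_num)
  have h0 := norm_nonneg w
  rw [antilinearPart_apply]
  fin_cases j
  · have := hrow 0
    simp only [Fin.zero_eta, Matrix.cons_val_zero]
    linarith
  · have := hrow 1
    simp only [Fin.mk_one, Matrix.cons_val_one, Matrix.cons_val_zero]
    linarith
  · have := hrow 2
    have := norm_sub_le (t 2 0 * conj (w 0) + t 2 1 * conj (w 1)) (paramDet t * conj (w 2))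
    simp only [Fin.reduceFinMk, Matrix.cons_val]
    linarith

/-- The values of `(α_t, β_t, γ_t)` in terms of those of the left-invariant coframe. -/
def deformedCoframe (t : Param) : C3 →L[ℝ] C3 := ContinuousLinearMap.id ℝ C3 + antilinearPart t

lemma deformedCoframe_apply (t : Param) (w : C3) :
    deformedCoframe t w = w + antilinearPart t w := rfl

lemma deformedCoframe_zero (w : C3) : deformedCoframe 0 w = w := by
  simp [deformedCoframe_apply, antilinearPart_zero]

lemma deformedCoframe_injective {t : Param} (ht : ‖t‖ < 1 / 10) :
    Function.Injective (deformedCoframe t) := by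
  refine (injective_iff_map_eq_zero _).2 fun w hw => ?_
  have h1 : antilinearPart t w = -w := (neg_eq_of_add_eq_zero_right hw).symm
  have h2 : ‖antilinearPart t w‖ ≤ 1 / 4 * ‖w‖ :=
    (pi_norm_le_iff_of_nonneg (by positivity)).2 (norm_antilinearPart_apply_le ht w)
  rw [h1, norm_neg] at h2
  exact norm_eq_zero.1 (le_antisymm (by linarith) (norm_nonneg w))

/-- The change from the coframe `(α_t, β_t, γ_t)` to `(dζ₁, dζ₂, dζ₃)`. -/
def shear (a b : ℂ) : C3 →L[ℝ] C3 :=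
  ContinuousLinearMap.pi ![ContinuousLinearMap.proj 0, ContinuousLinearMap.proj 1,
    ContinuousLinearMap.proj 2 + a • ContinuousLinearMap.proj 1 + b • ContinuousLinearMap.proj 0]

lemma shear_apply (a b : ℂ) (u : C3) : shear a b u = ![u 0, u 1, u 2 + a * u 1 + b * u 0] := by
  ext i; fin_cases i <;> simp [shear]

lemma shear_injective (a b : ℂ) : Function.Injective (shear a b) := by
  refine Function.LeftInverse.injective (g := shear (-a) (-b)) fun u => ?_
  ext i; fin_cases i <;> simp [shear_apply]; ring

lemma shear_smul (a b c : ℂ) (u : C3) : shear a b (c • u) = c • shear a b u := by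
  ext i; fin_cases i <;> simp [shear_apply]; ring

/-- The quadratic terms of ζ₃ are chosen so that γ_t = φ₃ + t₃₁ φ̄₁ + t₃₂ φ̄₂ - D(t) φ̄₃. The point
enters otherwise only through the shear, which is complex linear and so does not affect J_t. -/
lemma hasFDerivAt_zeta (t : Param) (z : C3) :
    HasFDerivAt (zeta t) (shear (z 0) (t 1 0 * conj (z 0) + t 1 1 * conj (z 1)) ∘L
      deformedCoframe t ∘L coframe z) z := by
  have h : ∀ i : Fin 3, HasFDerivAt (fun z : C3 => z i)
      (ContinuousLinearMap.proj i : C3 →L[ℝ] ℂ) z := fun i => hasFDerivAt_apply i z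
  have hc : ∀ i : Fin 3, HasFDerivAt (fun z : C3 => conj (z i))
      (Complex.conjCLE.toContinuousLinearMap ∘L (ContinuousLinearMap.proj i : C3 →L[ℝ] ℂ)) z :=
    fun i => Complex.conjCLE.toContinuousLinearMap.hasFDerivAt.comp z (h i)
  have hsq : ∀ i j : Fin 3, HasFDerivAt (fun z : C3 => conj (z i) * conj (z j)) _ z :=
    fun i j => (hc i).mul (hc j)
  rw [hasFDerivAt_pi']
  intro i
  fin_cases i
  · refine ((h 0).add (((hc 0).const_mul (t 0 0)).add ((hc 1).const_mul (t 0 1)))).congr_fderiv ?_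
    ext v
    simp [shear_apply, deformedCoframe_apply, antilinearPart_apply, coframe_apply]
  · refine ((h 1).add (((hc 0).const_mul (t 1 0)).add ((hc 1).const_mul (t 1 1)))).congr_fderiv ?_
    ext v
    simp [shear_apply, deformedCoframe_apply, antilinearPart_apply, coframe_apply]
  · have hz : (fun z : C3 => zeta t z 2) = fun z : C3 =>
        z 2 + ((t 2 0 + t 1 0 * z 0) * conj (z 0) + (t 2 1 + t 1 1 * z 0) * conj (z 1))
      + (1 / 2) * (t 0 0 * t 1 0 * (conj (z 0) * conj (z 0))
          + 2 * (t 0 0 * t 1 1) * (conj (z 0) * conj (z 1))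
          + t 0 1 * t 1 1 * (conj (z 1) * conj (z 1)))
      - paramDet t * conj (z 2) := by
      funext z
      simp [zeta, sq]
    refine HasFDerivAt.congr_fderiv (f := fun z : C3 => zeta t z 2) (by
      rw [hz]
      exact (((h 2).add (((((h 0).const_mul (t 1 0)).const_add (t 2 0)).mul (hc 0)).add
        ((((h 0).const_mul (t 1 1)).const_add (t 2 1)).mul (hc 1)))).add
        (((((hsq 0 0).const_mul (t 0 0 * t 1 0)).add
          ((hsq 0 1).const_mul (2 * (t 0 0 * t 1 1)))).add
          ((hsq 1 1).const_mul (t 0 1 * t 1 1))).const_mul (1 / 2))).sub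
          ((hc 2).const_mul (paramDet t))) ?_
    ext v
    simp [shear_apply, deformedCoframe_apply, antilinearPart_apply, coframe_apply, paramDet]
    ring

lemma dzeta_apply (t : Param) (j : Fin 3) (z : C3) (v : Fin 1 → C3) :
    dzeta t j z v = shear (z 0) (t 1 0 * conj (z 0) + t 1 1 * conj (z 1))
      (deformedCoframe t (coframe z (v 0))) j := by
  change fderiv ℝ (fun w => zeta t w j) z (v 0) = _
  rw [(hasFDerivAt_pi'.1 (hasFDerivAt_zeta t z) j).fderiv]
  rfl

lemma alphaForm_apply (t : Param) (z : C3) (v : Fin 1 → C3) :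
    alphaForm t z v = deformedCoframe t (coframe z (v 0)) 0 := by
  simp [alphaForm, dzeta_apply, shear_apply]

lemma betaForm_apply (t : Param) (z : C3) (v : Fin 1 → C3) :
    betaForm t z v = deformedCoframe t (coframe z (v 0)) 1 := by
  simp [betaForm, dzeta_apply, shear_apply]

lemma gammaForm_apply (t : Param) (z : C3) (v : Fin 1 → C3) :
    gammaForm t z v = deformedCoframe t (coframe z (v 0)) 2 := by
  simp [gammaForm, dzeta_apply, shear_apply]
  ring

lemma wedge_oneForm_apply (a b : AltForm 1) (v : Fin 2 → C3) :
    (wedge a b : AltForm 2) v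
      = a (fun _ => v 0) * b (fun _ => v 1) - a (fun _ => v 1) * b (fun _ => v 0) := by
  have hu : (Finset.univ : Finset (Equiv.Perm (Fin 2))) = {1, Equiv.swap 0 1} := by decide
  have h : ∀ σ : Equiv.Perm (Fin 2), tensor a b (v ∘ σ)
      = a (fun _ => v (σ 0)) * b (fun _ => v (σ 1)) := fun σ => by
    change a _ * b _ = _
    congr 2 <;> funext i <;> fin_cases i <;> rfl
  have h2 : (wedge a b : AltForm 2) v = ((((1 : ℕ).factorial : ℂ) * ((1 : ℕ).factorial : ℂ))⁻¹) •
      ∑ σ : Equiv.Perm (Fin 2), Equiv.Perm.sign σ • tensor a b (v ∘ σ) :=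
    congrArg (((((1 : ℕ).factorial : ℂ) * ((1 : ℕ).factorial : ℂ))⁻¹) • ·)
      (ContinuousMultilinearMap.alternatization_apply_apply (tensor a b) v)
  rw [h2, hu, Finset.sum_pair (by decide)]
  simp only [h]
  simp [Units.smul_def, sub_eq_add_neg]

/-- The standard positive `(1, 1)`-form `i ∑ dz_j ∧ dz̄_j`. -/
def stdForm (u w : C3) : ℂ := ∑ j, Complex.I * (u j * conj (w j) - w j * conj (u j))

lemma omegaForm_apply (t : Param) (z : C3) (v : Fin 2 → C3) :
    omegaForm t z v = stdForm (deformedCoframe t (coframe z (v 0)))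
      (deformedCoframe t (coframe z (v 1))) := by
  have h : omegaForm t z v
      = Complex.I * (wedge (alphaForm t z) (conjForm (alphaForm t z)) : AltForm 2) v
      + Complex.I * (wedge (betaForm t z) (conjForm (betaForm t z)) : AltForm 2) v
      + Complex.I * (wedge (gammaForm t z) (conjForm (gammaForm t z)) : AltForm 2) v := rfl
  have hc : ∀ (a : AltForm 1) (v : Fin 1 → C3), conjForm a v = conj (a v) := fun _ _ => rfl
  rw [h]
  simp only [wedge_oneForm_apply, hc, alphaForm_apply, betaForm_apply, gammaForm_apply, stdForm,
    Fin.sum_univ_three]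

lemma isLeftInvariant_omegaForm (t : Param) : IsLeftInvariant (omegaForm t) :=
  isLeftInvariant_of_apply (omegaForm t 0) fun z v => by
    simp only [omegaForm_apply, coframe_zero]

lemma stdForm_I_smul (u w : C3) : stdForm (Complex.I • u) (Complex.I • w) = stdForm u w := by
  refine Finset.sum_congr rfl fun j _ => ?_
  simp only [Pi.smul_apply, smul_eq_mul, map_mul, Complex.conj_I]
  linear_combination (-Complex.I * (u j * conj (w j) - w j * conj (u j))) * Complex.I_mul_I

lemma stdForm_neg_right (u w : C3) : stdForm u (-w) = stdForm w u := by
  refine Finset.sum_congr rfl fun j _ => ?_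
  simp only [Pi.neg_apply, map_neg]
  ring

lemma conj_stdForm (u w : C3) : conj (stdForm u w) = stdForm u w := by
  rw [stdForm, map_sum]
  refine Finset.sum_congr rfl fun j _ => ?_
  simp only [map_mul, map_sub, Complex.conj_I, Complex.conj_conj]
  ring

/-- Source of both positivity statements: q = 0 serves ω_t with J_t, and q = A_t p serves ω_t^{1,1}
with J_0. -/
lemma stdForm_add_I_smul_sub (p q : C3) : stdForm (p + q) (Complex.I • (p - q))
    = ((2 * ∑ j, (‖p j‖ ^ 2 - ‖q j‖ ^ 2) : ℝ) : ℂ) := by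
  rw [stdForm, Finset.mul_sum, Complex.ofReal_sum]
  refine Finset.sum_congr rfl fun j _ => ?_
  push_cast
  rw [← Complex.mul_conj', ← Complex.mul_conj']
  simp only [Pi.add_apply, Pi.smul_apply, Pi.sub_apply, smul_eq_mul, map_mul, map_add, map_sub,
    Complex.conj_I]
  linear_combination (-2 * (p j * conj (p j) - q j * conj (q j))) * Complex.I_mul_I

/-! ### The complex structures -/

lemma deformedCoframe_complexStr {t : Param} (ht : ‖t‖ < 1 / 10) (z v : C3) :
    deformedCoframe t (coframe z (complexStr t z v))
      = Complex.I • deformedCoframe t (coframe z v) := by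
  set A := fderiv ℝ (zeta t) z with hA
  have hA' := (hasFDerivAt_zeta t z).fderiv
  have hinj : Function.Injective A := by
    rw [hA, hA']
    exact (shear_injective _ _).comp ((deformedCoframe_injective ht).comp (coframe_injective z))
  -- Invertibility is essential: `ContinuousLinearMap.inverse` is 0 on non-invertible maps.
  have hinv : A.IsInvertible := by
    refine ⟨(LinearEquiv.ofInjectiveEndo A.toLinearMap hinj).toContinuousLinearEquiv, ?_⟩
    ext; rfl
  have h : A (complexStr t z v) = Complex.I • A v :=
    ((hinv.inverse_apply_eq).1 rfl).symm
  rw [hA, hA'] at h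
  refine shear_injective (z 0) (t 1 0 * conj (z 0) + t 1 1 * conj (z 1)) ?_
  rw [shear_smul]
  exact h

lemma complexStr_zero_apply (z v : C3) : complexStr 0 z v = Complex.I • v := by
  have h := deformedCoframe_complexStr (t := 0) (by simp) z v
  rw [deformedCoframe_zero, deformedCoframe_zero, ← coframe_smul] at h
  exact coframe_injective z h

lemma isLeftInvariantEnd_complexStr {t : Param} (ht : ‖t‖ < 1 / 10) :
    IsLeftInvariantEnd (complexStr t) := by
  intro z v
  refine deformedCoframe_injective ht ?_
  have h := deformedCoframe_complexStr ht 0 (coframe z v)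
  rw [coframe_zero, coframe_zero] at h
  rw [h, deformedCoframe_complexStr ht]

lemma isAlmostComplexOnX_complexStr {t : Param} (ht : ‖t‖ < 1 / 10) :
    IsAlmostComplexOnX (complexStr t) := by
  refine (isLeftInvariantEnd_complexStr ht).isAlmostComplexOnX fun v => ?_
  refine coframe_injective 0 (deformedCoframe_injective ht ?_)
  rw [deformedCoframe_complexStr ht, deformedCoframe_complexStr ht, smul_smul, Complex.I_mul_I]
  simp

/-- The two choices of the (1,0) slot give the mixed terms ω(Jv, w), ω(v, Jw) opposite coefficients
±i/4, so these cancel; the other terms get 1/4 twice, since (-i)i = 1. -/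
lemma typeComp_one_one_apply (J : C3 →L[ℝ] C3) (ω : AltForm 2) (v : Fin 2 → C3) :
    typeComp J 1 1 ω v = (ω v + ω fun i => J (v i)) / 2 := by
  have hS : (Finset.univ.filter fun S : Finset (Fin 2) => S.card = 1 ∧ Sᶜ.card = 1)
      = {{0}, {1}} := by decide
  have hT : (Finset.univ : Finset (Finset (Fin 2))) = {∅, {0}, {1}, {0, 1}} := by decide
  have h0 : (fun i : Fin 2 => if i ∈ (∅ : Finset (Fin 2)) then J (v i) else v i) = v := by
    simp
  have h1 : (fun i : Fin 2 => if i ∈ ({0, 1} : Finset (Fin 2)) then J (v i) else v i)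
      = fun i => J (v i) := by
    funext i; fin_cases i <;> simp
  change (∑ S : Finset (Fin 2) with S.card = 1 ∧ Sᶜ.card = 1, splitEval J S ω) v = _
  rw [hS, Finset.sum_pair (by decide), add_apply, splitEval_apply, splitEval_apply, hT,
    Finset.sum_insert (by decide), Finset.sum_insert (by decide), Finset.sum_pair (by decide),
    Finset.sum_insert (by decide), Finset.sum_insert (by decide), Finset.sum_pair (by decide),
    h0, h1, Finset.prod_pair (by decide), Finset.prod_pair (by decide)]
  simp
  ring

/-! ### The metrics -/

lemma isHermitianMetric_omegaForm {t : Param} (ht : ‖t‖ < 1 / 10) :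
    IsHermitianMetric (complexStr t) (omegaForm t) where
  complexStructure := isAlmostComplexOnX_complexStr ht
  form := (isLeftInvariant_omegaForm t).isFormOnX
  type_one_one z := by
    ext v
    rw [typeComp_one_one_apply]
    simp only [omegaForm_apply, deformedCoframe_complexStr ht, stdForm_I_smul]
    ring
  real z := by
    ext v
    change conj (omegaForm t z v) = _
    rw [omegaForm_apply, conj_stdForm]
  pos z v hv := by
    have h0 : deformedCoframe t (coframe z v) ≠ 0 := by
      intro h
      refine hv (coframe_injective z (deformedCoframe_injective ht ?_))
      rw [h, map_zero, map_zero]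
    obtain ⟨j, hj⟩ := Function.ne_iff.1 h0
    have h := stdForm_add_I_smul_sub (deformedCoframe t (coframe z v)) 0
    rw [add_zero, sub_zero] at h
    rw [omegaForm_apply]
    simp only [Matrix.cons_val_zero, Matrix.cons_val_one, deformedCoframe_complexStr ht]
    rw [h, Complex.ofReal_re]
    refine mul_pos two_pos (Finset.sum_pos' (fun i _ => by simp) ⟨j, Finset.mem_univ j, ?_⟩)
    simpa using pow_pos (norm_pos_iff.2 hj) 2

lemma omegaForm11_apply (t : Param) (z : C3) (v : Fin 2 → C3) :
    omegaForm11 t z v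
      = (omegaForm t z v + omegaForm t z fun i => Complex.I • v i) / 2 := by
  rw [omegaForm11, typeComp_one_one_apply]
  simp only [complexStr_zero_apply]

lemma isLeftInvariant_omegaForm11 (t : Param) : IsLeftInvariant (omegaForm11 t) :=
  (isLeftInvariantEnd_complexStr (t := 0) (by simp)).typeComp 1 1 (isLeftInvariant_omegaForm t)

lemma I_smul_I_smul (v : C3) : Complex.I • Complex.I • v = -v := by
  rw [smul_smul, Complex.I_mul_I, neg_one_smul]

lemma isHermitianMetric_omegaForm11 {t : Param} (ht : ‖t‖ < 1 / 10) :
    IsHermitianMetric (complexStr 0) (omegaForm11 t) where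
  complexStructure := isAlmostComplexOnX_complexStr (by simp)
  form := (isLeftInvariant_omegaForm11 t).isFormOnX
  type_one_one z := by
    ext v
    rw [typeComp_one_one_apply]
    simp only [omegaForm11_apply, omegaForm_apply, complexStr_zero_apply, I_smul_I_smul, map_neg,
      stdForm_neg_right]
    ring
  real z := by
    ext v
    change conj (omegaForm11 t z v) = _
    simp only [omegaForm11_apply, omegaForm_apply, map_div₀, map_add, conj_stdForm, map_ofNat]
  pos z v hv := by
    set p := coframe z v with hp
    have hp0 : 0 < ‖p‖ := by
      refine norm_pos_iff.2 fun h => hv (coframe_injective z ?_)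
      rw [map_zero, ← hp, h]
    have hI : deformedCoframe t (coframe z (Complex.I • v))
        = Complex.I • (p - antilinearPart t p) := by
      rw [coframe_smul, deformedCoframe_apply, antilinearPart_I_smul, smul_sub, sub_eq_add_neg]
    -- The two halves of the average agree: ω(iv, i·iv) = ω(iv, -v) = ω(v, iv).
    have h : omegaForm11 t z ![v, complexStr 0 z v]
        = stdForm (p + antilinearPart t p) (Complex.I • (p - antilinearPart t p)) := by
      simp only [omegaForm11_apply, omegaForm_apply, Matrix.cons_val_zero, Matrix.cons_val_one,
        complexStr_zero_apply, I_smul_I_smul, map_neg, stdForm_neg_right, hI]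
      rw [← hp, deformedCoframe_apply]
      ring
    rw [h, stdForm_add_I_smul_sub, Complex.ofReal_re]
    refine mul_pos two_pos ?_
    -- The sup norm is attained at a coordinate, so ∑ |p_j|² ≥ ‖p‖², while the three antilinear
    -- terms contribute at most (3/16)‖p‖².
    obtain ⟨j, hj⟩ : ∃ j, ‖p j‖ = ‖p‖ := by
      by_contra! hne
      exact lt_irrefl _ ((pi_norm_lt_iff hp0).2 fun j => (norm_le_pi_norm p j).lt_of_ne (hne j))
    have h1 : ‖p‖ ^ 2 ≤ ∑ j, ‖p j‖ ^ 2 := by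
      rw [← hj]
      exact Finset.single_le_sum (f := fun j => ‖p j‖ ^ 2) (fun i _ => by positivity)
        (Finset.mem_univ j)
    have h2 : ∑ j, ‖antilinearPart t p j‖ ^ 2 ≤ ∑ _j : Fin 3, (1 / 4 * ‖p‖) ^ 2 :=
      Finset.sum_le_sum fun j _ =>
        pow_le_pow_left₀ (norm_nonneg _) (norm_antilinearPart_apply_le ht p j) 2
    rw [Finset.sum_sub_distrib]
    simp only [Finset.sum_const, Finset.card_univ, Fintype.card_fin, nsmul_eq_mul] at h2
    push_cast at h2
    nlinarith [pow_pos hp0 2]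

/-! ### Joint smoothness in the parameter and the point -/

lemma contDiff_conj_comp {E : Type*} [NormedAddCommGroup E] [NormedSpace ℝ E] {n : WithTop ℕ∞}
    {f : E → ℂ} (hf : ContDiff ℝ n f) : ContDiff ℝ n fun x => conj (f x) :=
  Complex.conjCLE.contDiff.comp hf

lemma contDiff_deformedCoframe_coframe (w : C3) {n : WithTop ℕ∞} :
    ContDiff ℝ n fun p : Param × C3 => deformedCoframe p.1 (coframe p.2 w) := by
  have ht : ∀ i l, ContDiff ℝ n fun p : Param × C3 => p.1 i l := fun i l => by fun_prop
  have hz : ∀ i, ContDiff ℝ n fun p : Param × C3 => coframe p.2 w i := fun i =>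
    contDiff_pi.1 ((contDiff_coframe_apply w).comp contDiff_snd) i
  have hc := fun i => contDiff_conj_comp (hz i)
  have hD : ContDiff ℝ n fun p : Param × C3 => paramDet p.1 :=
    ((ht 0 0).mul (ht 1 1)).sub ((ht 0 1).mul (ht 1 0))
  simp only [deformedCoframe_apply, antilinearPart_apply]
  refine ((contDiff_coframe_apply w).comp contDiff_snd).add (contDiff_pi.2 fun i => ?_)
  fin_cases i
  · exact ((ht 0 0).mul (hc 0)).add ((ht 0 1).mul (hc 1))
  · exact ((ht 1 0).mul (hc 0)).add ((ht 1 1).mul (hc 1))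
  · exact (((ht 2 0).mul (hc 0)).add ((ht 2 1).mul (hc 1))).sub (hD.mul (hc 2))

lemma contDiff_omegaForm_apply (v : Fin 2 → C3) {n : WithTop ℕ∞} :
    ContDiff ℝ n fun p : Param × C3 => omegaForm p.1 p.2 v := by
  simp only [omegaForm_apply, stdForm]
  have h := fun i j => contDiff_pi.1 (contDiff_deformedCoframe_coframe (n := n) (v i)) j
  exact ContDiff.sum fun j _ => contDiff_const.mul
    (((h 0 j).mul (contDiff_conj_comp (h 1 j))).sub ((h 1 j).mul (contDiff_conj_comp (h 0 j))))

lemma contDiff_omegaForm11 {n : WithTop ℕ∞} :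
    ContDiff ℝ n fun p : Param × C3 => omegaForm11 p.1 p.2 := by
  refine contDiff_altForm fun v => ?_
  simp only [omegaForm11_apply]
  exact ((contDiff_omegaForm_apply v).add (contDiff_omegaForm_apply _)).div_const 2

end Iwasawa

end

theorem proposition6p2 :
    ∃ ε : ℝ, 0 < ε ∧
      (∀ t : Iwasawa.Param, ‖t‖ < ε →
        Iwasawa.IsGauduchonMetric (Iwasawa.complexStr 0) (Iwasawa.omegaForm11 t)) ∧
      ContDiffOn ℝ (⊤ : ℕ∞)
        (fun p : Iwasawa.Param × Iwasawa.C3 => Iwasawa.omegaForm11 p.1 p.2)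
        (Metric.ball (0 : Iwasawa.Param) ε ×ˢ (Set.univ : Set Iwasawa.C3)) ∧
      Iwasawa.omegaForm11 0 = Iwasawa.omegaForm 0 ∧
      (∀ t : Iwasawa.Param, ‖t‖ < ε → t 2 0 = 0 → t 2 1 = 0 →
        Iwasawa.IsGauduchonMetric (Iwasawa.complexStr t) (Iwasawa.omegaForm t)) := by
  refine ⟨1 / 10, by norm_num, fun t ht => ?_, Iwasawa.contDiff_omegaForm11.contDiffOn, ?_,
    fun t ht _ _ => ?_⟩
  · exact (Iwasawa.isHermitianMetric_omegaForm11 ht).isGauduchonMetric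
      (Iwasawa.isLeftInvariantEnd_complexStr (by simp)) (Iwasawa.isLeftInvariant_omegaForm11 t)
  -- ω_0 is already of type (1,1) for J_0.
  · exact funext (Iwasawa.isHermitianMetric_omegaForm (t := 0) (by simp)).type_one_one
  · exact (Iwasawa.isHermitianMetric_omegaForm ht).isGauduchonMetric
      (Iwasawa.isLeftInvariantEnd_complexStr ht) (Iwasawa.isLeftInvariant_omegaForm t)
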